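/- For $0<\delta<1$ let $$I(\delta):=\tfrac12\Big((1-\delta)\log(1-\delta)+(1+\delta)\log(1+\delta)\Big),$$ the relative entropy of a Bernoulli$\big(\tfrac{1-\delta}{2}\big)$ variable with respect to a Bernoulli$\big(\tfrac12\big)$ variable. Fix constants $0<c<c_p<\sqrt{\log 2}$ and $\delta\in(0,1)$ such that $c_p^2<I(\delta)$. For a positive integer $m$ put $$K(m):=\Big\lfloor \exp\big(c\sqrt{\log m}\big)\Big\rfloor,\qquad P(m):=\Big\lfloor \exp\big(c_p\sqrt{\log m}\big)\Big\rfloor.$$ Let $S$ be the set of positive integers $m$ such that, for all integers $k$ with $0\le k\le K(m)$ and all primes $p$, $$\nu_p\left(\binom{2m}{m}\right)-\nu_p\left(\binom{m+k}{m}\right)\ \ge\ \frac{1-\delta}{2}\,\frac{\log m}{\log p}\cdot[\,p\le P(m)\,],$$ where $\nu_p$ is the $p$-adic valuation and $[\,p\le P(m)\,]$ equals $1$ if $p\le P(m)$ and $0$ otherwise. Then $S$ has asymptotic density $1$, that is, $\frac1N\,\#\big(S\cap[1,N]\big)\to 1$ as $N\to\infty$. -/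

import Mathlib

open Filter Topology

noncomputable section

/-- A set `S` of natural numbers has asymptotic (natural) density `d` if the proportion of the
integers in `[1, N]` that lie in `S` tends to `d` as `N → ∞`. -/
def HasAsymptoticDensity (S : Set ℕ) (d : ℝ) : Prop :=
  Tendsto (fun N : ℕ => ((S ∩ Set.Icc 1 N).ncard : ℝ) / (N : ℝ)) atTop (𝓝 d)

/-- The rate function `I(δ)`, the relative entropy of a Bernoulli variable of parameter
`(1 - δ) / 2` with respect to a Bernoulli variable of parameter `1 / 2`. -/
def rateI (δ : ℝ) : ℝ :=
  1 / 2 * ((1 - δ) * Real.log (1 - δ) + (1 + δ) * Real.log (1 + δ))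

/-- `⌊exp (a √(log m))⌋`: the cutoff `K(m)` for `a = c`, and the cutoff `P(m)` for `a = c_p`. -/
def expSqrtLogFloor (a : ℝ) (m : ℕ) : ℕ :=
  ⌊Real.exp (a * Real.sqrt (Real.log (m : ℝ)))⌋₊

/-- The set of `m` such that for all `0 ≤ k ≤ K(m)` and all primes `p`,
`ν_p (2m choose m) - ν_p (m+k choose m) ≥ (1 - δ) / 2 * (log m / log p) * [p ≤ P(m)]`. -/
def gapSet (c cp δ : ℝ) : Set ℕ :=
  {m : ℕ | ∀ k : ℕ, k ≤ expSqrtLogFloor c m → ∀ p : ℕ, p.Prime →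
    (padicValNat p ((2 * m).choose m) : ℝ) - (padicValNat p ((m + k).choose m) : ℝ) ≥
      (1 - δ) / 2 * (Real.log (m : ℝ) / Real.log (p : ℝ)) *
        (if p ≤ expSqrtLogFloor cp m then 1 else 0)}

end

/-! By Kummer's theorem both valuations count carries in base p. If p > P(m), then p ≥ 2k for large
m, so every carry in m + k is also a carry in m + m and the difference is nonnegative. If p ≤ P(m),
two kinds of m ≤ N are discarded. In `longRun`, m mod p^j lies within K of p^j; otherwise m + k has
at most j ≈ η log N / log p carries. In `fewCarries`, doubling m produces too few carries; these
form a two-state Markov chain, and a Chernoff bound makes this set exponentially small in log N /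
log p. A union bound over p ≤ P(N) finishes. With x = √(log N) there are at most exp(c_p x) primes,
and each large one costs about N exp(-a x / c_p) with c_p² < a < I(δ'), δ' < δ. The finitely many
small primes need only some exponential decay. -/

/-! ### Carries and valuations. -/

/-- The number of carries out of the first `J` digits when `m` is doubled in base `p`. -/
def carryCount (p J m : ℕ) : ℕ :=
  ((Finset.Ico 1 (J + 1)).filter (fun i => p ^ i ≤ 2 * (m % p ^ i))).card

theorem carryCount_le_padicValNat {p : ℕ} (hp : p.Prime) (J m : ℕ) :
    carryCount p J m ≤ padicValNat p ((2 * m).choose m) := by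
  have := Fact.mk hp
  -- Any cutoff above the logarithm is allowed; the extra `J` makes the range contain all positions
  -- up to `J`.
  have h := padicValNat_choose' (p := p) (n := m) (k := m)
    (b := Nat.log p (m + m) + 1 + J) (by omega)
  rw [two_mul, h]
  apply Finset.card_le_card
  intro i hi
  simp only [Finset.mem_filter, Finset.mem_Ico] at hi ⊢
  omega

theorem padicValNat_choose_add_le_choose_two_mul {p m k : ℕ} (hp : p.Prime) (hk : 2 * k ≤ p) :
    padicValNat p ((m + k).choose m) ≤ padicValNat p ((2 * m).choose m) := by
  have := Fact.mk hp
  set b := max (Nat.log p (m + m)) (Nat.log p (k + m)) + 1 with hb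
  have h1 := padicValNat_choose' (p := p) (n := m) (k := m) (b := b) (by omega)
  have h2 := padicValNat_choose' (p := p) (n := k) (k := m) (b := b) (by omega)
  rw [two_mul, add_comm m k, h1, h2]
  apply Finset.card_le_card
  intro i hi
  simp only [Finset.mem_filter, Finset.mem_Ico] at hi ⊢
  have h3 : p ≤ p ^ i := Nat.le_self_pow (by omega) p
  have h4 : k % p ^ i ≤ k := Nat.mod_le _ _
  omega

/-- The distance from m up to the next multiple of p^i is at least that to the next multiple of p^j.
-/
theorem pow_le_mod_add_of_le {p i j m k : ℕ} (hp : 0 < p) (hij : j ≤ i)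
    (h : p ^ i ≤ m % p ^ i + k) : p ^ j ≤ m % p ^ j + k := by
  obtain ⟨t, rfl⟩ := Nat.exists_eq_add_of_le hij
  rw [pow_add, Nat.mod_mul] at h
  have h1 : m / p ^ j % p ^ t + 1 ≤ p ^ t := Nat.mod_lt _ (by positivity)
  have h2 := Nat.mul_le_mul_left (p ^ j) h1
  rw [mul_add, mul_one] at h2
  omega

theorem padicValNat_choose_add_le {p m k K j : ℕ} (hp : p.Prime) (hk : k ≤ K)
    (h : ¬ p ^ j ≤ m % p ^ j + K) : padicValNat p ((m + k).choose m) ≤ j := by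
  have := Fact.mk hp
  have h2 := padicValNat_choose' (p := p) (n := k) (k := m)
    (b := Nat.log p (k + m) + 1) (by omega)
  rw [add_comm m k, h2]
  calc _ ≤ (Finset.Ico 1 (j + 1)).card := by
        apply Finset.card_le_card
        intro i hi
        simp only [Finset.mem_filter, Finset.mem_Ico] at hi ⊢
        refine ⟨hi.1.1, ?_⟩
        by_contra hij
        apply h
        have h4 : k % p ^ i ≤ k := Nat.mod_le _ _
        exact pow_le_mod_add_of_le hp.pos (i := i) (by omega) (by omega)
    _ = j := by simp

/-! ### Counting by residue classes. -/

theorem card_filter_mod_le (Q : ℕ → Prop) [DecidablePred Q] {M : ℕ} (hM : 0 < M) (N : ℕ) :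
    ((Finset.Icc 1 N).filter (fun m => Q (m % M))).card ≤
      (N / M + 1) * ((Finset.range M).filter Q).card := by
  calc _ ≤ (Finset.range (N / M + 1) ×ˢ (Finset.range M).filter Q).card := by
        apply Finset.card_le_card_of_injOn (fun m => (m / M, m % M))
        · intro m hm
          simp only [Finset.coe_filter, Set.mem_ofPred_eq, Finset.mem_Icc] at hm
          simp only [Finset.coe_product, Set.mem_prod, Finset.mem_coe, Finset.mem_range,
            Finset.mem_filter]
          exact ⟨Nat.lt_succ_of_le (Nat.div_le_div_right hm.1.2), Nat.mod_lt _ hM, hm.2⟩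
        · intro a _ b _ hab
          simp only [Prod.mk.injEq] at hab
          rw [← Nat.div_add_mod a M, ← Nat.div_add_mod b M, hab.1, hab.2]
    _ = _ := by simp

theorem card_filter_mod_le_real (Q : ℕ → Prop) [DecidablePred Q] {M N : ℕ} (hM : 0 < M)
    (hMN : M ≤ N) :
    (((Finset.Icc 1 N).filter (fun m => Q (m % M))).card : ℝ) ≤
      2 * N / M * ((Finset.range M).filter Q).card := by
  have h := card_filter_mod_le Q hM N
  have h2 : (((N / M + 1 : ℕ)) : ℝ) ≤ 2 * N / M := by
    push_cast
    have := @Nat.cast_div_le ℝ _ _ _ N M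
    have h3 : (1 : ℝ) ≤ N / M := by
      rw [le_div_iff₀ (by exact_mod_cast hM)]
      simpa using (by exact_mod_cast hMN : (M : ℝ) ≤ N)
    rw [mul_div_assoc]
    linarith
  calc _ ≤ (((N / M + 1) * ((Finset.range M).filter Q).card : ℕ) : ℝ) := by exact_mod_cast h
    _ = ((N / M + 1 : ℕ) : ℝ) * ((Finset.range M).filter Q).card := by push_cast; ring
    _ ≤ _ := by gcongr

theorem card_filter_le_add_le (M K : ℕ) :
    ((Finset.range M).filter (fun r => M ≤ r + K)).card ≤ K := by
  calc _ ≤ (Finset.Ico (M - K) M).card := by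
        apply Finset.card_le_card
        intro r hr
        simp only [Finset.mem_filter, Finset.mem_range, Finset.mem_Ico] at hr ⊢
        omega
    _ ≤ K := by simp; omega

/-! ### Exponential moments of the carry chain. -/

theorem sum_range_mul_eq (f : ℕ → ℝ) (M n : ℕ) :
    ∑ r ∈ Finset.range (M * n), f r =
      ∑ r ∈ Finset.range M, ∑ d ∈ Finset.range n, f (M * d + r) := by
  induction n with
  | zero => simp
  | succ n ih =>
    rw [mul_add, mul_one, Finset.sum_range_add, ih, ← Finset.sum_add_distrib]
    exact Finset.sum_congr rfl fun r _ => (Finset.sum_range_succ _ _).symm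

theorem carryCount_mod {p J m : ℕ} : carryCount p J (m % p ^ J) = carryCount p J m := by
  unfold carryCount
  congr 1
  apply Finset.filter_congr
  intro i hi
  simp only [Finset.mem_Ico] at hi
  rw [Nat.mod_mod_of_dvd _ (pow_dvd_pow p (by omega : i ≤ J))]

/-- The Markov property: the outgoing carry depends only on the new digit and the incoming carry. -/
theorem pow_succ_le_two_mul_iff {p J r d : ℕ} (hr : r < p ^ J) :
    p ^ (J + 1) ≤ 2 * (p ^ J * d + r) ↔ p ≤ 2 * d + (if p ^ J ≤ 2 * r then 1 else 0) := by
  rw [pow_succ]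
  set M := p ^ J
  split_ifs with h
  · constructor
    · intro h1
      by_contra h2
      have h3 : 2 * d + 2 ≤ p := by omega
      have := Nat.mul_le_mul_left M h3
      nlinarith
    · intro h1
      have := Nat.mul_le_mul_left M h1
      nlinarith
  · constructor
    · intro h1
      by_contra h2
      have h3 : 2 * d + 1 ≤ p := by omega
      have := Nat.mul_le_mul_left M h3
      nlinarith
    · intro h1
      have := Nat.mul_le_mul_left M h1
      nlinarith

theorem carryCount_succ {p J r d : ℕ} (hr : r < p ^ J) (hd : d < p) :
    carryCount p (J + 1) (p ^ J * d + r) = carryCount p J r +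
      (if p ≤ 2 * d + (if p ^ J ≤ 2 * r then 1 else 0) then 1 else 0) := by
  have h0 : carryCount p J r = carryCount p J (p ^ J * d + r) := by
    rw [← carryCount_mod (m := p ^ J * d + r), Nat.mul_add_mod, Nat.mod_eq_of_lt hr]
  have hlt : p ^ J * d + r < p ^ (J + 1) := by
    have := Nat.mul_le_mul_left (p ^ J) (Nat.succ_le_of_lt hd)
    rw [pow_succ]
    rw [Nat.mul_succ] at this
    omega
  rw [h0]
  unfold carryCount
  rw [← Finset.insert_Ico_right_eq_Ico_add_one (by omega : 1 ≤ J + 1), Finset.filter_insert,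
    Nat.mod_eq_of_lt hlt]
  simp only [pow_succ_le_two_mul_iff hr]
  by_cases hQ : p ≤ 2 * d + (if p ^ J ≤ 2 * r then 1 else 0) <;> simp [hQ]

theorem sum_carry_step (p : ℕ) (u : ℝ) (x : ℕ) (hx : x ≤ 1) :
    ∑ d ∈ Finset.range p, (if p ≤ 2 * d + x then u else 1) =
      (p - ((p + x) / 2 : ℕ)) + ((p + x) / 2 : ℕ) * u := by
  rw [Finset.sum_ite, Finset.sum_const, Finset.sum_const]
  have h1 : ((Finset.range p).filter (fun d => p ≤ 2 * d + x)).card = (p + x) / 2 := by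
    have : (Finset.range p).filter (fun d => p ≤ 2 * d + x) =
        Finset.Ico (p - (p + x) / 2) p := by
      ext d
      simp only [Finset.mem_filter, Finset.mem_range, Finset.mem_Ico]
      omega
    rw [this, Nat.card_Ico]
    rcases p with _ | p <;> omega
  have h2 := Finset.card_filter_add_card_filter_not (s := Finset.range p)
    (fun d => p ≤ 2 * d + x)
  rw [Finset.card_range] at h2
  have h3 : (((Finset.range p).filter (fun d => ¬ p ≤ 2 * d + x)).card : ℝ) =
      p - ((p + x) / 2 : ℕ) := by
    rw [eq_sub_iff_add_eq, ← h1]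
    exact_mod_cast (add_comm _ _).trans h2
  simp only [nsmul_eq_mul, h3, h1]
  ring

/-- Exponential moment bound for the number of carries, by the Perron-Frobenius weight
`1, θ` on the two states of the carry chain. -/
theorem sum_pow_carryCount_le {p : ℕ} {s θ ρ : ℝ} (hs : 0 ≤ s)
    (h0 : (p - (p / 2 : ℕ)) + (p / 2 : ℕ) * (s * θ) ≤ p * ρ)
    (h1 : (p - ((p + 1) / 2 : ℕ)) + ((p + 1) / 2 : ℕ) * (s * θ) ≤ p * ρ * θ) (hρ : 0 ≤ ρ)
    (J : ℕ) :
    ∑ r ∈ Finset.range (p ^ J), s ^ carryCount p J r * (if p ^ J ≤ 2 * r then θ else 1) ≤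
      (p * ρ) ^ J := by
  induction J with
  | zero => simp [carryCount]
  | succ J ih =>
    rw [pow_succ p J, sum_range_mul_eq, pow_succ (p * ρ) J]
    refine le_trans ?_ (mul_le_mul_of_nonneg_right ih (by positivity))
    rw [Finset.sum_mul]
    apply Finset.sum_le_sum
    intro r hr
    rw [Finset.mem_range] at hr
    have key : ∀ d ∈ Finset.range p,
        s ^ carryCount p (J + 1) (p ^ J * d + r) *
          (if p ^ J * p ≤ 2 * (p ^ J * d + r) then θ else 1) =
        s ^ carryCount p J r *
          (if p ≤ 2 * d + (if p ^ J ≤ 2 * r then 1 else 0) then s * θ else 1) := by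
      intro d hd
      rw [carryCount_succ hr (Finset.mem_range.1 hd), ← pow_succ]
      simp only [pow_succ_le_two_mul_iff hr]
      split_ifs <;> ring
    rw [Finset.sum_congr rfl key, ← Finset.mul_sum, mul_assoc]
    apply mul_le_mul_of_nonneg_left _ (by positivity)
    rw [sum_carry_step _ _ _ (by split_ifs <;> omega)]
    split_ifs
    · linarith
    · simpa using h0

/-- Markov's inequality: each counted residue contributes at least s^(τJ) θ to the exponential
moment. -/
theorem card_carryCount_lt_le {p : ℕ} {s θ ρ τ : ℝ} (hp : 0 < p) (hs : 0 < s) (hs1 : s ≤ 1)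
    (hθ : 0 < θ) (hθ1 : θ ≤ 1)
    (h0 : (p - (p / 2 : ℕ)) + (p / 2 : ℕ) * (s * θ) ≤ p * ρ)
    (h1 : (p - ((p + 1) / 2 : ℕ)) + ((p + 1) / 2 : ℕ) * (s * θ) ≤ p * ρ * θ) (hρ : 0 ≤ ρ)
    {N : ℕ} (hN : N ≠ 0) :
    (((Finset.Icc 1 N).filter
      (fun m => (carryCount p (Nat.log p N) m : ℝ) < τ * Nat.log p N)).card : ℝ) ≤
      2 * N / θ * (ρ / s ^ τ) ^ Nat.log p N := by
  set J := Nat.log p N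
  have hM : 0 < p ^ J := by positivity
  have hMN : p ^ J ≤ N := Nat.pow_log_le_self p hN
  have hsτ : 0 < s ^ τ := Real.rpow_pos_of_pos hs τ
  have hpR : (0 : ℝ) < p := by exact_mod_cast hp
  classical
  have hc := card_filter_mod_le_real (fun r => (carryCount p J r : ℝ) < τ * J) hM hMN
  simp only [carryCount_mod] at hc
  have hr : (((Finset.range (p ^ J)).filter
      (fun r => (carryCount p J r : ℝ) < τ * J)).card : ℝ) * ((s ^ τ) ^ J * θ) ≤ (p * ρ) ^ J := by
    refine le_trans ?_ (sum_pow_carryCount_le hs.le h0 h1 hρ J)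
    rw [← nsmul_eq_mul]
    refine le_trans (Finset.card_nsmul_le_sum _ (fun r => s ^ carryCount p J r *
      (if p ^ J ≤ 2 * r then θ else 1)) _ ?_)
      (Finset.sum_le_sum_of_subset_of_nonneg (Finset.filter_subset _ _) ?_)
    · intro r hr
      have hr2 := (Finset.mem_filter.1 hr).2
      have e : (s ^ τ) ^ J ≤ s ^ carryCount p J r := by
        rw [← Real.rpow_natCast, ← Real.rpow_mul hs.le, ← Real.rpow_natCast s]
        exact Real.rpow_le_rpow_of_exponent_ge hs hs1 hr2.le
      have e2 : θ ≤ (if p ^ J ≤ 2 * r then θ else 1) := by split_ifs <;> linarith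
      gcongr
    · intro r _ _
      split_ifs <;> positivity
  have hr' := (le_div_iff₀ (by positivity)).2 hr
  refine hc.trans ((mul_le_mul_of_nonneg_left hr' (by positivity)).trans (le_of_eq ?_))
  rw [mul_pow, div_pow]
  push_cast
  field_simp

theorem card_pow_le_mod_add_le {p j K N : ℕ} (hp : 0 < p) (h : p ^ j ≤ N) :
    (((Finset.Icc 1 N).filter (fun m => p ^ j ≤ m % p ^ j + K)).card : ℝ) ≤
      2 * N / (p : ℝ) ^ j * K := by
  have h1 := card_filter_mod_le_real (fun r => p ^ j ≤ r + K) (by positivity : 0 < p ^ j) h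
  refine h1.trans ?_
  push_cast
  gcongr
  exact card_filter_le_add_le _ _

theorem hasAsymptoticDensity_one_of_bound {S : Set ℕ} [DecidablePred (· ∈ S)] {e : ℕ → ℝ}
    (he : Tendsto e atTop (𝓝 0))
    (h : ∀ᶠ N : ℕ in atTop, (((Finset.Icc 1 N).filter (· ∉ S)).card : ℝ) ≤ N * e N) :
    HasAsymptoticDensity S 1 := by
  have key : ∀ N : ℕ, ((S ∩ Set.Icc 1 N).ncard : ℝ) =
      N - ((Finset.Icc 1 N).filter (· ∉ S)).card := by
    intro N
    have h1 : S ∩ Set.Icc 1 N = ((Finset.Icc 1 N).filter (· ∈ S) : Finset ℕ) := by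
      ext m
      simp only [Set.mem_inter_iff, Set.mem_Icc, Finset.coe_filter, Finset.mem_Icc,
        Set.mem_ofPred_eq]
      tauto
    rw [h1, Set.ncard_coe_finset, eq_sub_iff_add_eq]
    have h2 := Finset.card_filter_add_card_filter_not (s := Finset.Icc 1 N) (· ∈ S)
    rw [Nat.card_Icc, Nat.add_sub_cancel] at h2
    exact_mod_cast h2
  unfold HasAsymptoticDensity
  have h1 : Tendsto (fun N => 1 - e N) atTop (𝓝 1) := by simpa using he.const_sub 1
  refine tendsto_of_tendsto_of_tendsto_of_le_of_le' h1 tendsto_const_nhds ?_ ?_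
  · filter_upwards [h, eventually_gt_atTop 0] with N hN hN0
    rw [key, le_div_iff₀ (by exact_mod_cast hN0)]
    linarith
  · filter_upwards [eventually_gt_atTop 0] with N hN0
    rw [key, div_le_iff₀ (by exact_mod_cast hN0)]
    simp

/-! ### Chernoff bounds for large primes and for all primes. -/

theorem exists_card_carryCount_lt_le_of_lt_rateI {δ a : ℝ} (hδ0 : 0 < δ) (hδ1 : δ < 1)
    (ha : a < rateI δ) : ∃ p₀ : ℕ, ∀ p : ℕ, p₀ ≤ p → 0 < p → ∀ N : ℕ, N ≠ 0 →
      (((Finset.Icc 1 N).filter (fun m =>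
        (carryCount p (Nat.log p N) m : ℝ) < (1 - δ) / 2 * Nat.log p N)).card : ℝ) ≤
      2 * N * Real.exp (-a) ^ Nat.log p N := by
  set τ := (1 - δ) / 2 with hτ
  -- The optimal tilt: (1 + s)/2 · s^(-τ) = exp(-I(δ)). Taking θ = 1 costs an O(1/p) parity error,
  -- absorbed by the slack in `a` once p ≥ p₀.
  set s := (1 - δ) / (1 + δ) with hs
  have hd1 : 0 < 1 - δ := by linarith
  have hd2 : 0 < 1 + δ := by linarith
  have hs0 : 0 < s := by positivity
  have hs1 : s ≤ 1 := by rw [hs, div_le_one hd2]; linarith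
  have hsτ : 0 < s ^ τ := Real.rpow_pos_of_pos hs0 τ
  set ρ := Real.exp (-a) * s ^ τ with hρ
  have hlt : (1 + s) / 2 < ρ := by
    have e1 : (1 + s) / 2 = Real.exp (-Real.log (1 + δ)) := by
      rw [Real.exp_neg, Real.exp_log hd2, hs]
      field_simp
      ring
    rw [e1, hρ, Real.rpow_def_of_pos hs0, ← Real.exp_add, Real.exp_lt_exp, hs,
      Real.log_div hd1.ne' hd2.ne', hτ]
    unfold rateI at ha
    linarith
  obtain ⟨p₀, hp₀⟩ := exists_nat_gt (1 / (ρ - (1 + s) / 2))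
  refine ⟨p₀, fun p hpp hp N hN => ?_⟩
  have hpR : (1 : ℝ) < p * (ρ - (1 + s) / 2) := by
    rw [div_lt_iff₀ (by linarith)] at hp₀
    have : (p₀ : ℝ) ≤ p := by exact_mod_cast hpp
    nlinarith
  have hhalf : ((p : ℝ) - 1) / 2 ≤ (p / 2 : ℕ) := by
    have : p ≤ 2 * (p / 2) + 1 := by omega
    have : (p : ℝ) ≤ 2 * (p / 2 : ℕ) + 1 := by exact_mod_cast this
    linarith
  have hhalf' : ((p : ℝ) - 1) / 2 ≤ ((p + 1) / 2 : ℕ) := by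
    have : p ≤ 2 * ((p + 1) / 2) + 1 := by omega
    have : (p : ℝ) ≤ 2 * ((p + 1) / 2 : ℕ) + 1 := by exact_mod_cast this
    linarith
  have h := card_carryCount_lt_le (p := p) (s := s) (θ := 1) (ρ := ρ) (τ := τ) hp hs0 hs1
    one_pos le_rfl (by nlinarith) (by nlinarith) (by positivity) hN
  rwa [div_one, hρ, mul_div_cancel_right₀ _ hsτ.ne'] at h

theorem exists_card_carryCount_lt_le_of_lt_half {τ : ℝ} (hτ0 : 0 ≤ τ) (hτ : τ < 1 / 2) :
    ∃ σ : ℝ, 0 < σ ∧ σ < 1 ∧ ∀ p : ℕ, p.Prime → ∀ N : ℕ, N ≠ 0 →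
      (((Finset.Icc 1 N).filter (fun m =>
        (carryCount p (Nat.log p N) m : ℝ) < τ * Nat.log p N)).card : ℝ) ≤
      4 * N * σ ^ Nat.log p N := by
  -- With tilt 1 - ε the exponent is at most -ε(1/2 - τ) + 2ε² = -2ε² < 0.
  set ε := (1 / 2 - τ) / 4 with hε
  have hε0 : 0 < ε := by rw [hε]; linarith
  have hε1 : ε ≤ 1 / 8 := by rw [hε]; linarith
  set σ := Real.exp (-(ε / 2) + ε ^ 2 + τ * (ε + 2 * ε ^ 2)) with hσ
  have hσ1 : σ < 1 := by
    rw [hσ, Real.exp_lt_one_iff]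
    nlinarith
  set ρ := Real.exp (-(ε / 2) + ε ^ 2) with hρ
  have hρ1 : 1 - ε / 2 + ε ^ 2 ≤ ρ := by
    have := Real.add_one_le_exp (-(ε / 2) + ε ^ 2)
    linarith
  have hs0 : 0 < 1 - ε := by linarith
  have hratio : ρ / (1 - ε) ^ τ ≤ σ := by
    rw [div_le_iff₀ (Real.rpow_pos_of_pos hs0 τ), Real.rpow_def_of_pos hs0, hσ, hρ,
      ← Real.exp_add, Real.exp_le_exp]
    have h1 := Real.one_sub_inv_le_log_of_pos hs0
    have h2 : -(ε + 2 * ε ^ 2) ≤ 1 - (1 - ε)⁻¹ := by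
      have : (1 - ε)⁻¹ ≤ 1 + ε + 2 * ε ^ 2 := by
        rw [inv_le_iff_one_le_mul₀ hs0]
        nlinarith [sq_nonneg ε]
      linarith
    nlinarith
  refine ⟨σ, Real.exp_pos _, hσ1, fun p hp N hN => ?_⟩
  have main : ∃ θ : ℝ, 1 / 2 ≤ θ ∧ θ ≤ 1 ∧
      ((p : ℝ) - (p / 2 : ℕ)) + (p / 2 : ℕ) * ((1 - ε) * θ) ≤ p * ρ ∧
      ((p : ℝ) - ((p + 1) / 2 : ℕ)) + ((p + 1) / 2 : ℕ) * ((1 - ε) * θ) ≤ p * ρ * θ := by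
    rcases hp.eq_two_or_odd' with rfl | ⟨k, rfl⟩
    · refine ⟨1, by norm_num, le_rfl, ?_, ?_⟩ <;> norm_num <;> nlinarith
    · have hk : 1 ≤ k := by have := hp.two_le; omega
      have e1 : (2 * k + 1) / 2 = k := by omega
      have e2 : (2 * k + 1 + 1) / 2 = k + 1 := by omega
      rw [e1, e2]
      have hkR : (1 : ℝ) ≤ k := by exact_mod_cast hk
      push_cast
      -- The weight 1 - y is the first-order eigenvector: k and k + 1 digits carry from the two
      -- states, and ky = ε/2 makes both rows lose (2k + 1)ε/2.
      set y := ε / (2 * k) with hy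
      have hyk : k * y = ε / 2 := by rw [hy]; field_simp
      have hy0 : 0 ≤ y := by positivity
      have hye : y ≤ ε / 2 := by nlinarith
      refine ⟨1 - y, by linarith, by linarith, ?_, ?_⟩
      · have h1 : (k : ℝ) * ((1 - ε) * (1 - y)) = k * (1 - ε) - (1 - ε) * (ε / 2) := by
          rw [← hyk]; ring
        rw [h1]
        have h2 : (2 * (k : ℝ) + 1) * (1 - ε / 2 + ε ^ 2) ≤ (2 * k + 1) * ρ := by gcongr
        nlinarith [mul_nonneg (by linarith : (0 : ℝ) ≤ k) (sq_nonneg ε)]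
      · have h2 : (2 * (k : ℝ) + 1) * (1 - ε / 2 + ε ^ 2) * (1 - y) ≤
            (2 * k + 1) * ρ * (1 - y) := by
          have : 0 ≤ 1 - y := by linarith
          gcongr
        refine le_trans ?_ h2
        have h3 : (2 * (k : ℝ) + 1) * (1 - ε / 2 + ε ^ 2) * (1 - y) -
            (2 * k + 1 - (k + 1) + (k + 1) * ((1 - ε) * (1 - y))) =
            ε / 2 - k * y - y * ε / 2 + (1 - y) * (2 * k + 1) * ε ^ 2 := by ring
        have h4 : y * ε ≤ ε ^ 2 := by nlinarith
        have h5 : 1 ≤ (1 - y) * (2 * (k : ℝ) + 1) := by nlinarith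
        have h6 := mul_le_mul_of_nonneg_right h5 (sq_nonneg ε)
        rw [hyk] at h3
        nlinarith
  obtain ⟨θ, hθ, hθ1, h0, h1⟩ := main
  have h := card_carryCount_lt_le (τ := τ) hp.pos hs0 (by linarith) (by linarith) hθ1 h0 h1
    (Real.exp_pos _).le hN
  refine h.trans ?_
  have h2 : 2 * (N : ℝ) / θ ≤ 4 * N := by
    rw [div_le_iff₀ (by linarith)]
    have : (0 : ℝ) ≤ N := by positivity
    nlinarith
  have h3 : 0 ≤ ρ / (1 - ε) ^ τ := div_nonneg (Real.exp_pos _).le (Real.rpow_nonneg hs0.le _)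
  gcongr

/-! ### Sizes of the cutoffs. -/

theorem expSqrtLogFloor_le_exp (a : ℝ) (N : ℕ) :
    (expSqrtLogFloor a N : ℝ) ≤ Real.exp (a * √(Real.log N)) :=
  Nat.floor_le (Real.exp_pos _).le

theorem expSqrtLogFloor_mono {a : ℝ} (ha : 0 ≤ a) {m N : ℕ} (hm : 0 < m) (h : m ≤ N) :
    expSqrtLogFloor a m ≤ expSqrtLogFloor a N := by
  have hm' : (0 : ℝ) < m := by exact_mod_cast hm
  unfold expSqrtLogFloor
  gcongr

theorem tendsto_sqrt_log_natCast : Tendsto (fun N : ℕ => √(Real.log N)) atTop atTop :=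
  Real.tendsto_sqrt_atTop.comp (Real.tendsto_log_atTop.comp tendsto_natCast_atTop_atTop)

theorem eventually_two_mul_expSqrtLogFloor_le {c d : ℝ} (h : c < d) :
    ∀ᶠ m : ℕ in atTop, 2 * expSqrtLogFloor c m ≤ expSqrtLogFloor d m := by
  filter_upwards [tendsto_sqrt_log_natCast.eventually_ge_atTop (Real.log 2 / (d - c))] with m hm
  apply Nat.le_floor
  push_cast
  rw [div_le_iff₀ (by linarith)] at hm
  calc _ ≤ 2 * Real.exp (c * √(Real.log m)) := by
        gcongr
        exact expSqrtLogFloor_le_exp c m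
    _ = Real.exp (Real.log 2 + c * √(Real.log m)) := by
        rw [Real.exp_add, Real.exp_log two_pos]
    _ ≤ _ := by
        rw [Real.exp_le_exp]
        linarith

theorem exists_lt_rateI_of_lt {δ a : ℝ} (hδ0 : 0 < δ) (hδ1 : δ < 1) (h : a < rateI δ) :
    ∃ δ', 0 < δ' ∧ δ' < δ ∧ a < rateI δ' := by
  have hc : ContinuousAt rateI δ := by
    unfold rateI
    have h1 : 1 - δ ≠ 0 := by linarith
    have h2 : 1 + δ ≠ 0 := by linarith
    fun_prop (disch := assumption)
  have h1 : ∀ᶠ y in 𝓝[<] δ, a < rateI y :=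
    (hc.eventually (lt_mem_nhds h)).filter_mono nhdsWithin_le_nhds
  have h2 : ∀ᶠ y in 𝓝[<] δ, y ∈ Set.Ioo 0 δ := Ioo_mem_nhdsLT hδ0
  obtain ⟨y, hy1, hy2⟩ := (h1.and h2).exists
  exact ⟨y, hy2.1, hy2.2, hy1⟩

theorem log_div_log_sub_one_lt_log (p N : ℕ) (hp : 1 < p) (hN : N ≠ 0) :
    Real.log N / Real.log p - 1 < Nat.log p N := by
  have hlp : 0 < Real.log p := Real.log_pos (by exact_mod_cast hp)
  rw [sub_lt_iff_lt_add, div_lt_iff₀ hlp]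
  have h := Nat.lt_pow_succ_log_self hp N
  have h2 : (N : ℝ) < (p : ℝ) ^ (Nat.log p N + 1) := by exact_mod_cast h
  have h3 := Real.log_lt_log (by positivity) h2
  rw [Real.log_pow] at h3
  exact_mod_cast h3

/-- If `p ≤ exp (b √(log N))` then `√(log N) ≤ b log N / log p`. -/
theorem sqrt_log_div_le {b : ℝ} (hb : 0 < b) {p N : ℕ} (hp : 1 < p)
    (h : p ≤ expSqrtLogFloor b N) : √(Real.log N) / b ≤ Real.log N / Real.log p := by
  have hlp : 0 < Real.log p := Real.log_pos (by exact_mod_cast hp)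
  have h1 : (p : ℝ) ≤ Real.exp (b * √(Real.log N)) :=
    le_trans (by exact_mod_cast h) (expSqrtLogFloor_le_exp b N)
  have h2 : Real.log p ≤ b * √(Real.log N) := (Real.log_le_iff_le_exp (by positivity)).2 h1
  rw [div_le_div_iff₀ hb hlp]
  have h3 : √(Real.log N) * √(Real.log N) = Real.log N :=
    Real.mul_self_sqrt (Real.log_natCast_nonneg N)
  nlinarith [Real.sqrt_nonneg (Real.log N)]

/-! ### Exceptional sets and their sizes. -/

/-- The set of `m ≤ N` whose base `p` expansion nearly ends, below the digit `j`, in a run of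
digits `p - 1`. -/
def longRun (p j K N : ℕ) : Finset ℕ :=
  (Finset.Icc 1 N).filter (fun m => p ^ j ≤ m % p ^ j + K)

/-- The set of `m ≤ N` with few carries when doubled in base `p`. -/
noncomputable def fewCarries (p : ℕ) (τ : ℝ) (N : ℕ) : Finset ℕ :=
  open Classical in
  (Finset.Icc 1 N).filter
    (fun m => (carryCount p (Nat.log p N) m : ℝ) < τ * Nat.log p N)

/-- With L = log N / log p, the difference is at least τ'(L - 1) - ηL; `hL` pays for the rounding
loss τ'. -/
theorem le_padicValNat_sub_of_notMem {p m k K N : ℕ} {τ τ' η : ℝ} (hp : p.Prime)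
    (hm1 : 1 ≤ m) (hmN : m ≤ N) (hk : k ≤ K) (hτ : 0 ≤ τ) (hη : 0 ≤ η) (hτ' : 0 ≤ τ')
    (hL : τ' ≤ (τ' - τ - η) * (Real.log N / Real.log p))
    (hA : m ∉ longRun p ⌊η * (Real.log N / Real.log p)⌋₊ K N) (hB : m ∉ fewCarries p τ' N) :
    τ * (Real.log m / Real.log p) ≤
      (padicValNat p ((2 * m).choose m) : ℝ) - padicValNat p ((m + k).choose m) := by
  have hlp : 0 < Real.log p := Real.log_pos (by exact_mod_cast hp.one_lt)
  have hlN : 0 ≤ Real.log N := Real.log_natCast_nonneg N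
  simp only [longRun, fewCarries, Finset.mem_filter, Finset.mem_Icc, hm1, hmN, true_and,
    not_lt] at hA hB
  have h1 := padicValNat_choose_add_le hp hk hA
  have h1' : (padicValNat p ((m + k).choose m) : ℝ) ≤ η * (Real.log N / Real.log p) :=
    le_trans (by exact_mod_cast h1) (Nat.floor_le (by positivity))
  have h2 : (carryCount p (Nat.log p N) m : ℝ) ≤ padicValNat p ((2 * m).choose m) := by
    exact_mod_cast carryCount_le_padicValNat hp _ m
  have h3 := log_div_log_sub_one_lt_log p N hp.one_lt (by omega)
  have h4 : Real.log m / Real.log p ≤ Real.log N / Real.log p := by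
    have : (0 : ℝ) < m := by exact_mod_cast hm1
    gcongr
  have h5 := mul_le_mul_of_nonneg_left h4 hτ
  have h6 := mul_le_mul_of_nonneg_left h3.le hτ'
  nlinarith

/-- The proportion is at most 2K/p^j; the floor in j loses at most a factor p ≤ exp(b x), x = √(log
N). -/
theorem card_longRun_le {p N : ℕ} {c b η : ℝ} (hp : p.Prime) (hN : N ≠ 0)
    (hη : 0 ≤ η) (hη1 : η ≤ 1) (hpb : p ≤ expSqrtLogFloor b N) :
    ((longRun p ⌊η * (Real.log N / Real.log p)⌋₊ (expSqrtLogFloor c N) N).card : ℝ) ≤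
      2 * N * Real.exp ((c + b) * √(Real.log N) - η * √(Real.log N) ^ 2) := by
  have hlp : 0 < Real.log p := Real.log_pos (by exact_mod_cast hp.one_lt)
  have hlN : 0 ≤ Real.log N := Real.log_natCast_nonneg N
  have hpR : (0 : ℝ) < p := by exact_mod_cast hp.pos
  have hNR : (0 : ℝ) < N := by exact_mod_cast Nat.pos_of_ne_zero hN
  set j := ⌊η * (Real.log N / Real.log p)⌋₊ with hj
  have hj1 : (j : ℝ) ≤ η * (Real.log N / Real.log p) := Nat.floor_le (by positivity)
  have hj2 : η * (Real.log N / Real.log p) < j + 1 := Nat.lt_floor_add_one _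
  have hpj : (p : ℝ) ^ j = Real.exp (j * Real.log p) := by
    rw [mul_comm, Real.exp_mul, Real.exp_log hpR, Real.rpow_natCast]
  have hle : p ^ j ≤ N := by
    have : (p : ℝ) ^ j ≤ N := by
      rw [hpj, ← Real.le_log_iff_exp_le hNR, ← le_div_iff₀ hlp]
      have : 0 ≤ Real.log N / Real.log p := by positivity
      nlinarith
    exact_mod_cast this
  have hlow : Real.exp (η * Real.log N - b * √(Real.log N)) ≤ (p : ℝ) ^ j := by
    rw [hpj, Real.exp_le_exp]
    have h1 : (p : ℝ) ≤ Real.exp (b * √(Real.log N)) :=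
      le_trans (by exact_mod_cast hpb) (expSqrtLogFloor_le_exp b N)
    have h2 : Real.log p ≤ b * √(Real.log N) := (Real.log_le_iff_le_exp hpR).2 h1
    have h3 := mul_le_mul_of_nonneg_right hj2.le hlp.le
    rw [mul_assoc, div_mul_cancel₀ _ hlp.ne'] at h3
    linarith
  have hcard := card_pow_le_mod_add_le (K := expSqrtLogFloor c N) hp.pos hle
  unfold longRun
  refine hcard.trans ?_
  calc _ ≤ 2 * N / Real.exp (η * Real.log N - b * √(Real.log N)) *
        Real.exp (c * √(Real.log N)) := by
        gcongr
        exact expSqrtLogFloor_le_exp c N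
    _ = _ := by
        rw [Real.sq_sqrt hlN, div_mul_eq_mul_div, mul_div_assoc, ← Real.exp_sub]
        ring_nf

theorem card_biUnion_le_mul {S : Finset ℕ} {f : ℕ → Finset ℕ} {M : ℕ} {B : ℝ} (hB : 0 ≤ B)
    (hS : S ⊆ Finset.Icc 1 M) (h : ∀ p ∈ S, ((f p).card : ℝ) ≤ B) :
    ((S.biUnion f).card : ℝ) ≤ M * B := by
  calc ((S.biUnion f).card : ℝ) ≤ ∑ p ∈ S, ((f p).card : ℝ) := by
        exact_mod_cast Finset.card_biUnion_le
    _ ≤ S.card • B := Finset.sum_le_card_nsmul _ _ _ h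
    _ ≤ _ := by
        rw [nsmul_eq_mul]
        have : S.card ≤ M := by simpa using Finset.card_le_card hS
        gcongr

/-! ### The union bound. -/

theorem theorem3 (c cp δ : ℝ) (hc : 0 < c) (hccp : c < cp)
    (hcp : cp < Real.sqrt (Real.log 2)) (hδ0 : 0 < δ) (hδ1 : δ < 1)
    (hI : cp ^ 2 < rateI δ) :
    HasAsymptoticDensity (gapSet c cp δ) 1 := by
  classical
  have hcp0 : 0 < cp := hc.trans hccp
  obtain ⟨δ', hδ'0, hδ', hI'⟩ := exists_lt_rateI_of_lt hδ0 hδ1 hI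
  obtain ⟨a, ha, haI⟩ := exists_between hI'
  obtain ⟨p₀, hlarge⟩ := exists_card_carryCount_lt_le_of_lt_rateI hδ'0 (hδ'.trans hδ1) haI
  obtain ⟨σ, hσ0, hσ1, hsmall⟩ :=
    exists_card_carryCount_lt_le_of_lt_half (τ := (1 - δ') / 2) (by linarith) (by linarith)
  obtain ⟨m₀, hm₀⟩ := eventually_atTop.1 (eventually_two_mul_expSqrtLogFloor_le hccp)
  -- A quarter, so that (1 - δ')/2 - (1 - δ)/2 - η = η is left for rounding.
  set η := (δ - δ') / 4 with hη
  have hη0 : 0 < η := by rw [hη]; linarith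
  have hη1 : η ≤ 1 := by rw [hη]; linarith
  have ha0 : 0 < a := lt_trans (by positivity) ha
  set q := p₀ + 2 with hq
  -- The terms account for m < m₀, long runs, few carries at p ≥ p₀, and few carries at p ≤ q.
  set e : ℕ → ℝ := fun N => m₀ / N +
    2 * Real.exp ((c + 2 * cp) * √(Real.log N) - η * √(Real.log N) ^ 2) +
    2 * Real.exp (a - (a / cp - cp) * √(Real.log N)) + q * (4 * σ ^ Nat.log q N) with he
  -- Here c_p² < a is used: the decay per prime beats the number of primes.
  have hgap : 0 < a / cp - cp := by
    rw [sub_pos, lt_div_iff₀ hcp0]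
    nlinarith
  have hlim : Tendsto e atTop (𝓝 0) := by
    have t1 : Tendsto (fun N : ℕ => (m₀ : ℝ) / N) atTop (𝓝 0) :=
      tendsto_const_div_atTop_nhds_zero_nat _
    have tlin : ∀ u v : ℝ, 0 < v → Tendsto (fun x : ℝ => u - v * x) atTop atBot := by
      intro u v hv
      simp only [sub_eq_add_neg]
      exact tendsto_atBot_add_const_left _ _
        (tendsto_neg_atTop_atBot.comp (tendsto_id.const_mul_atTop hv))
    have t2 : Tendsto (fun x : ℝ => Real.exp ((c + 2 * cp) * x - η * x ^ 2)) atTop (𝓝 0) := by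
      refine Real.tendsto_exp_atBot.comp ?_
      refine (tendsto_id.atTop_mul_atBot₀ (tlin (c + 2 * cp) η hη0)).congr fun x => ?_
      simp only [id]
      ring
    have t3 : Tendsto (fun x : ℝ => Real.exp (a - (a / cp - cp) * x)) atTop (𝓝 0) :=
      Real.tendsto_exp_atBot.comp (tlin _ _ hgap)
    have t4 : Tendsto (fun N : ℕ => σ ^ Nat.log q N) atTop (𝓝 0) := by
      refine (tendsto_pow_atTop_nhds_zero_of_lt_one hσ0.le hσ1).comp ?_
      refine tendsto_atTop_atTop.2 fun b => ⟨q ^ b, fun N hN => ?_⟩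
      exact Nat.le_log_of_pow_le (by omega) hN
    have t := ((t1.add ((t2.comp tendsto_sqrt_log_natCast).const_mul 2)).add
      ((t3.comp tendsto_sqrt_log_natCast).const_mul 2)).add ((t4.const_mul 4).const_mul (q : ℝ))
    simpa [he, Function.comp_def] using t
  refine hasAsymptoticDensity_one_of_bound hlim ?_
  filter_upwards [eventually_gt_atTop 0,
    tendsto_sqrt_log_natCast.eventually_ge_atTop ((1 - δ') / 2 / η * cp)] with N hN0 hNx
  have hN : N ≠ 0 := hN0.ne'
  have hNR : (0 : ℝ) < N := by exact_mod_cast hN0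
  set x := √(Real.log N) with hx
  set K := expSqrtLogFloor c N with hK
  set P := expSqrtLogFloor cp N with hP
  have hPx : (P : ℝ) ≤ Real.exp (cp * x) := expSqrtLogFloor_le_exp cp N
  set S := (Finset.Icc 1 P).filter Nat.Prime with hS
  set A : ℕ → Finset ℕ := fun p => longRun p ⌊η * (Real.log N / Real.log p)⌋₊ K N with hA
  set B : ℕ → Finset ℕ := fun p => fewCarries p ((1 - δ') / 2) N with hB
  have hcover : (Finset.Icc 1 N).filter (· ∉ gapSet c cp δ) ⊆
      ((Finset.range m₀ ∪ S.biUnion A) ∪ (S.filter (p₀ ≤ ·)).biUnion B) ∪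
        ((Finset.Icc 1 q).filter Nat.Prime).biUnion B := by
    intro m hm
    simp only [Finset.mem_filter, Finset.mem_Icc] at hm
    obtain ⟨⟨hm1, hmN⟩, hmG⟩ := hm
    by_contra hcon
    simp only [Finset.mem_union, not_or, Finset.mem_range, not_lt, Finset.mem_biUnion,
      not_exists, not_and] at hcon
    obtain ⟨⟨⟨c1, c2⟩, c3⟩, c4⟩ := hcon
    apply hmG
    intro k hk p hp
    split_ifs with hpP
    · rw [mul_one, ge_iff_le]
      have hpP' : p ≤ P := hpP.trans (expSqrtLogFloor_mono hcp0.le hm1 hmN)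
      have hk' : k ≤ K := hk.trans (expSqrtLogFloor_mono hc.le hm1 hmN)
      have hpS : p ∈ S := Finset.mem_filter.2 ⟨Finset.mem_Icc.2 ⟨hp.one_le, hpP'⟩, hp⟩
      have hpB : m ∉ B p := by
        by_cases h : p₀ ≤ p
        · exact c3 p (Finset.mem_filter.2 ⟨hpS, h⟩)
        · exact c4 p (Finset.mem_filter.2 ⟨Finset.mem_Icc.2 ⟨hp.one_le, by omega⟩, hp⟩)
      refine le_padicValNat_sub_of_notMem (τ' := (1 - δ') / 2) hp hm1 hmN hk' (by linarith)
        hη0.le (by linarith) ?_ (c2 p hpS) hpB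
      have e1 : (1 - δ') / 2 - (1 - δ) / 2 - η = η := by rw [hη]; ring
      rw [e1, mul_comm, ← div_le_iff₀ hη0]
      refine le_trans ?_ (sqrt_log_div_le hcp0 hp.one_lt hpP')
      rwa [le_div_iff₀ hcp0]
    · rw [mul_zero, ge_iff_le, sub_nonneg]
      have := hm₀ m c1
      exact_mod_cast padicValNat_choose_add_le_choose_two_mul hp (by omega)
  have hS1 : S ⊆ Finset.Icc 1 P := Finset.filter_subset _ _
  have hSp : ∀ p ∈ S, p.Prime ∧ p ≤ P := fun p hp =>
    ⟨(Finset.mem_filter.1 hp).2, (Finset.mem_Icc.1 (Finset.mem_filter.1 hp).1).2⟩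
  have b2 : ((S.biUnion A).card : ℝ) ≤
      N * (2 * Real.exp ((c + 2 * cp) * x - η * x ^ 2)) := by
    refine (card_biUnion_le_mul (B := 2 * N * Real.exp ((c + cp) * x - η * x ^ 2))
      (by positivity) hS1 fun p hp =>
        card_longRun_le (hSp p hp).1 hN hη0.le hη1 (hSp p hp).2).trans ?_
    calc _ ≤ Real.exp (cp * x) * (2 * N * Real.exp ((c + cp) * x - η * x ^ 2)) := by gcongr
      _ = N * (2 * (Real.exp (cp * x) * Real.exp ((c + cp) * x - η * x ^ 2))) := by ring
      _ = _ := by rw [← Real.exp_add]; ring_nf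
  have b3 : (((S.filter (p₀ ≤ ·)).biUnion B).card : ℝ) ≤
      N * (2 * Real.exp (a - (a / cp - cp) * x)) := by
    refine (card_biUnion_le_mul (B := 2 * N * Real.exp (a - a / cp * x)) (by positivity)
      ((Finset.filter_subset _ _).trans hS1) fun p hp => ?_).trans ?_
    · obtain ⟨hpS, hpp⟩ := Finset.mem_filter.1 hp
      have hpr := (hSp p hpS).1
      refine le_trans (by
        simp only [hB, fewCarries]
        convert hlarge p hpp hpr.pos N hN) ?_
      rw [← Real.exp_nat_mul]
      gcongr
      have h1 := sqrt_log_div_le hcp0 hpr.one_lt (hSp p hpS).2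
      have h2 := log_div_log_sub_one_lt_log p N hpr.one_lt hN
      have h3 : x / cp - 1 ≤ Nat.log p N := by linarith
      have h4 := mul_le_mul_of_nonneg_left h3 ha0.le
      have h5 : a / cp * x = a * (x / cp) := by ring
      rw [h5]
      linarith
    · calc _ ≤ Real.exp (cp * x) * (2 * N * Real.exp (a - a / cp * x)) := by gcongr
        _ = N * (2 * (Real.exp (cp * x) * Real.exp (a - a / cp * x))) := by ring
        _ = _ := by rw [← Real.exp_add]; ring_nf
  have b4 : ((((Finset.Icc 1 q).filter Nat.Prime).biUnion B).card : ℝ) ≤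
      N * (q * (4 * σ ^ Nat.log q N)) := by
    refine (card_biUnion_le_mul (B := 4 * N * σ ^ Nat.log q N) (by positivity)
      (Finset.filter_subset _ _) fun p hp => ?_).trans (le_of_eq (by ring))
    obtain ⟨hpq, hpr⟩ := Finset.mem_filter.1 hp
    refine le_trans (by
        simp only [hB, fewCarries]
        convert hsmall p hpr N hN) ?_
    gcongr 4 * N * ?_
    exact pow_le_pow_of_le_one hσ0.le hσ1.le
      (Nat.log_anti_left hpr.one_lt (Finset.mem_Icc.1 hpq).2)
  have hN1 : (N : ℝ) * (m₀ / N) = m₀ := mul_div_cancel₀ _ hNR.ne'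
  calc (((Finset.Icc 1 N).filter (· ∉ gapSet c cp δ)).card : ℝ)
      ≤ ((Finset.range m₀).card : ℝ) + (S.biUnion A).card +
        ((S.filter (p₀ ≤ ·)).biUnion B).card +
        (((Finset.Icc 1 q).filter Nat.Prime).biUnion B).card := by
        have u1 := Finset.card_le_card hcover
        have u2 := Finset.card_union_le
          ((Finset.range m₀ ∪ S.biUnion A) ∪ (S.filter (p₀ ≤ ·)).biUnion B)
          (((Finset.Icc 1 q).filter Nat.Prime).biUnion B)
        have u3 := Finset.card_union_le (Finset.range m₀ ∪ S.biUnion A)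
          ((S.filter (p₀ ≤ ·)).biUnion B)
        have u4 := Finset.card_union_le (Finset.range m₀) (S.biUnion A)
        exact_mod_cast (by omega)
    _ ≤ N * e N := by
        rw [Finset.card_range]
        simp only [he, mul_add, hN1]
        linarith
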